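/- Conventions. For a small preadditive category $\mathcal A$, let $\mathrm{Mod}\,\mathcal A$ be the category of right $\mathcal A$-modules, i.e. of additive functors $\mathcal A^{\mathrm{op}}\to \mathrm{Ab}$. Two small preadditive categories $\mathcal A$ and $\mathcal B$ are Morita equivalent if $\mathrm{Mod}\,\mathcal A\simeq\mathrm{Mod}\,\mathcal B$. A recollement of an abelian category $\mathcal M$ by abelian categories $\mathcal Y$ and $\mathcal X$ consists of additive functors $i_*\colon\mathcal Y\to\mathcal M$, $i^*,i^!\colon\mathcal M\to\mathcal Y$, $j^*\colon\mathcal M\to\mathcal X$ and $j_!,j_*\colon\mathcal X\to\mathcal M$ such that $(i^*,i_*,i^!)$ and $(j_!,j^*,j_*)$ are adjoint triples, $i_*,j_!,j_*$ are fully faithful, and the essential image of $i_*$ is $\mathrm{Ker}(j^*)$. It is equivalent to a recollement $(\mathcal Y',\mathcal M',\mathcal X')$ if there are equivalences of categories $\Phi\colon\mathcal M\to\mathcal M'$ and $\Psi\colon\mathcal X\to\mathcal X'$ with $\Psi\circ j^*\cong (j^*)'\circ\Phi$. For a set $\mathcal E$ of idempotent endomorphisms of objects of a small preadditive category $\mathcal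 B$, let $\mathcal B\mathcal E\mathcal B$ be the two-sided ideal generated by $\mathcal E$, so that $(\mathcal B\mathcal E\mathcal B)(a,b)$ is the subgroup of $\mathcal B(a,b)$ generated by the compositions $\delta\circ\epsilon\circ\gamma$ with $\epsilon\in\mathcal E$. The quotient category $\mathcal B/\mathcal B\mathcal E\mathcal B$ has the objects of $\mathcal B$ and the morphism groups $\mathcal B(a,b)/(\mathcal B\mathcal E\mathcal B)(a,b)$. The corner category $\mathcal C_{\mathcal E}$ has $\mathcal E$ as its set of objects; its morphisms from $\epsilon\colon x\to x$ to $\epsilon'\colon x'\to x'$ are the morphisms $x\to x'$ in $\mathcal B$ of the form $\epsilon'\circ\beta\circ\epsilon$, with the composition of $\mathcal B$. Theorem. Let $\mathcal A$ be a small preadditive category, and let $\mathcal R$ be a recollement of $\mathrm{Mod}\,\mathcal A$ by abelian categories $\mathcal Y$ and $\mathcal X$, each of which is equivalent to the category of modules over some small preadditive category. Then there are a small preadditive category $\mathcal B$ Morita equivalent to $\mathcal A$ and a set $\mathcal E$ of idempotent endomorphisms in $\mathcal B$ such that $\mathcal R$ is equivalent to a recollement of the form $$\mathrm{Mod}(\mathcal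 B/\mathcal B\mathcal E\mathcal B)\xrightarrow{\;i_*\;}\mathrm{Mod}\,\mathcal B\xrightarrow{\;j^*\;}\mathrm{Mod}\,\mathcal C_{\mathcal E},$$ where, up to natural isomorphism, $i_*$ is restriction of scalars along the projection $\mathcal B\to\mathcal B/\mathcal B\mathcal E\mathcal B$ and $j^*$ sends a module $M$ to the $\mathcal C_{\mathcal E}$-module $(\epsilon\colon x\to x)\mapsto M(\epsilon)(M(x))\subseteq M(x)$, on which morphisms of $\mathcal C_{\mathcal E}$ act by restriction. -/

import Mathlib

open CategoryTheory CategoryTheory.Limits CategoryTheory.Idempotents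

universe u v u₁ v₁ u₂ v₂ u₃ v₃ u₄ v₄ u₅ v₅ u₆ v₆

noncomputable section

namespace RecollementMod

/-! ### Modules over small preadditive categories -/

/-- The category of right modules over a small preadditive category `C`:
additive functors from `Cᵒᵖ` to abelian groups, and natural transformations. -/
abbrev ModOver (C : Type u) [SmallCategory C] [Preadditive C] :=
  Cᵒᵖ ⥤+ AddCommGrpCat.{u}

section Abelian

variable (C : Type u) [SmallCategory C] [Preadditive C]

instance : (additiveFunctor Cᵒᵖ AddCommGrpCat.{u}).ContainsZero where
  exists_zero := by
    have h : IsZero ((Functor.const Cᵒᵖ).obj (AddCommGrpCat.of.{u} PUnit)) :=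
      Functor.isZero _ fun _ =>
        AddCommGrpCat.isZero_of_subsingleton (AddCommGrpCat.of.{u} PUnit)
    exact ⟨_, h, Functor.Additive.of_isZero h⟩

instance : (additiveFunctor Cᵒᵖ AddCommGrpCat.{u}).IsClosedUnderSubobjects where
  prop_of_mono {F G} i _ hG := by
    have : G.Additive := hG
    refine (⟨fun {a b f g} => ?_⟩ : F.Additive)
    rw [← cancel_mono (i.app b)]
    simp [Preadditive.add_comp, Preadditive.comp_add]

instance : (additiveFunctor Cᵒᵖ AddCommGrpCat.{u}).IsClosedUnderQuotients where
  prop_of_epi {F G} p _ hF := by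
    have : F.Additive := hF
    refine (⟨fun {a b f g} => ?_⟩ : G.Additive)
    rw [← cancel_epi (p.app a)]
    simp [← NatTrans.naturality, Preadditive.add_comp, Preadditive.comp_add]

instance : (additiveFunctor Cᵒᵖ AddCommGrpCat.{u}).IsClosedUnderFiniteProducts where
  isClosedUnderLimitsOfShape J _ :=
    { limitsOfShape_le := by
        rintro F ⟨p⟩
        refine (⟨fun {a b f g} => ?_⟩ : F.Additive)
        have hb := isLimitOfPreserves ((evaluation Cᵒᵖ AddCommGrpCat.{u}).obj b) p.isLimit
        refine hb.hom_ext fun j => ?_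
        have : (p.diag.obj j).Additive := p.prop_diag_obj j
        change F.map (f + g) ≫ (p.π.app j).app b = (F.map f + F.map g) ≫ (p.π.app j).app b
        rw [Preadditive.add_comp, NatTrans.naturality, NatTrans.naturality, NatTrans.naturality,
          Functor.map_add, Preadditive.comp_add] }

/-- A module category is abelian: the additive functors are closed under kernels, cokernels and
finite products in the abelian category of all functors. -/
instance : Abelian (ModOver C) :=
  (inferInstance : Abelian (additiveFunctor Cᵒᵖ AddCommGrpCat.{u}).FullSubcategory)

end Abelian

/-- `A` and `B` are Morita equivalent if their module categories are equivalent. -/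
def MoritaEquivalent (A : Type u) [SmallCategory A] [Preadditive A]
    (B : Type u) [SmallCategory B] [Preadditive B] : Prop :=
  Nonempty (ModOver A ≌ ModOver B)

/-- A category equivalent to the category of modules over some small preadditive category. -/
def IsModuleCategory (X : Type u₁) [Category.{v₁} X] : Prop :=
  ∃ (D : Type u) (_ : SmallCategory D) (_ : Preadditive D), Nonempty (X ≌ ModOver D)

/-- Restriction of scalars `M ↦ M ∘ φ` along an additive functor `φ`. -/
def restrictScalars {C D : Type u} [SmallCategory C] [Preadditive C]
    [SmallCategory D] [Preadditive D] (φ : C ⥤ D) [φ.Additive] : ModOver D ⥤ ModOver C where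
  obj M := AdditiveFunctor.of (φ.op ⋙ M.obj)
  map f := ObjectProperty.homMk (Functor.whiskerLeft φ.op f.hom)

/-! ### Ideals and quotient categories -/

/-- A two-sided ideal of a preadditive category. -/
structure CatIdeal (C : Type u) [Category.{v} C] [Preadditive C] where
  /-- the subgroup of those morphisms `a ⟶ b` that belong to the ideal -/
  carrier (a b : C) : AddSubgroup (a ⟶ b)
  comp_mem {a' a b b' : C} (r : a' ⟶ a) {f : a ⟶ b} (l : b ⟶ b') (hf : f ∈ carrier a b) :
    r ≫ f ≫ l ∈ carrier a' b'

namespace CatIdeal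

section

variable {C : Type u} [Category.{v} C] [Preadditive C] (I : CatIdeal C)

/-- Two parallel morphisms are identified modulo `I` if their difference is in `I`. -/
def homRel : HomRel C := fun a b f g => f - g ∈ I.carrier a b

instance : Congruence I.homRel where
  equivalence {a b} :=
    { refl := fun f => by simp [homRel]
      symm := fun {f g} h => by
        have := (I.carrier a b).neg_mem h
        simpa [homRel] using this
      trans := fun {f g h} h₁ h₂ => by
        have := (I.carrier a b).add_mem h₁ h₂
        simpa [homRel] using this }
  comp_left {a b c} f {g g'} h := by
    have := I.comp_mem f (𝟙 c) h
    simpa [homRel, Preadditive.comp_sub] using this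
  comp_right {a b c} {f f'} g h := by
    have := I.comp_mem (𝟙 a) g h
    simpa [homRel, Preadditive.sub_comp] using this

lemma homRel_add ⦃a b : C⦄ (f₁ f₂ g₁ g₂ : a ⟶ b) (hf : I.homRel f₁ f₂) (hg : I.homRel g₁ g₂) :
    I.homRel (f₁ + g₁) (f₂ + g₂) := by
  have := (I.carrier a b).add_mem hf hg
  simp only [homRel]
  convert! this using 1
  abel

/-- The quotient category `C / I`: the objects of `C`, with morphism groups
`C(a, b) / I(a, b)`. -/
abbrev QuotientCategory := Quotient I.homRel

instance : Preadditive I.QuotientCategory := Quotient.preadditive I.homRel I.homRel_add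

/-- The projection `C ⥤ C / I`. -/
abbrev proj : C ⥤ I.QuotientCategory := Quotient.functor I.homRel

instance : I.proj.Additive := Quotient.functor_additive I.homRel I.homRel_add

end

end CatIdeal

/-! ### Sets of idempotent endomorphisms

A set of idempotent endomorphisms of objects of `C` is a set of objects of `Karoubi C`, since
an object of `Karoubi C` is an object `X` of `C` with an endomorphism `p` such that
`p ≫ p = p`. -/

section Idempotent

variable {C : Type u} [Category.{v} C] [Preadditive C]

/-- The ideal `C E C` generated by a set `E` of idempotent endomorphisms: its elements
are the finite sums of compositions `δ ∘ ε ∘ γ` with `ε` in `E`. -/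
def idealGenerated (E : Set (Karoubi C)) : CatIdeal C where
  carrier a b := AddSubgroup.closure
    {f | ∃ ε ∈ E, ∃ (γ : a ⟶ ε.X) (δ : ε.X ⟶ b), f = γ ≫ ε.p ≫ δ}
  comp_mem {a' a b b'} r {f} l hf := by
    induction hf using AddSubgroup.closure_induction with
    | mem f hf =>
      obtain ⟨ε, hε, γ, δ, rfl⟩ := hf
      exact AddSubgroup.subset_closure ⟨ε, hε, r ≫ γ, δ ≫ l, by simp⟩
    | zero => simp
    | add f g _ _ hf hg => simpa using AddSubgroup.add_mem _ hf hg
    | neg f _ hf => simpa using AddSubgroup.neg_mem _ hf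

/-- The corner category of `E`: its objects are the members of `E`, and the morphisms from
`ε : x ⟶ x` to `ε' : x' ⟶ x'` are the `α : x ⟶ x'` that can be written `ε' ∘ β ∘ ε`;
see `exists_corner_hom_iff`. -/
abbrev CornerCategory (E : Set (Karoubi C)) :=
  ObjectProperty.FullSubcategory (fun ε : Karoubi C => ε ∈ E)

end Idempotent

/-- The morphisms of the corner category, in terms of decompositions. -/
lemma exists_corner_hom_iff {C : Type u} [Category.{v} C] (E : Set (Karoubi C)) (ε ε' : CornerCategory E)
    (α : ε.obj.X ⟶ ε'.obj.X) :
    (∃ f : ε ⟶ ε', f.hom.f = α) ↔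
      ∃ β : ε.obj.X ⟶ ε'.obj.X, α = ε.obj.p ≫ β ≫ ε'.obj.p := by
  constructor
  · rintro ⟨f, rfl⟩
    exact ⟨f.hom.f, f.hom.comm.symm⟩
  · rintro ⟨β, rfl⟩
    exact ⟨ObjectProperty.homMk ⟨ε.obj.p ≫ β ≫ ε'.obj.p, by simp⟩, rfl⟩

section CornerFunctor

variable {B : Type u} [SmallCategory B] [Preadditive B] (E : Set (Karoubi B))

/-- The module over the corner category of `E` that a `B`-module `M` defines: it sends
`ε : x ⟶ x` to the subgroup `M(ε)(M(x))` of `M(x)`, and a morphism `α` to the restriction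
of `M(α)`. -/
def cornerModule (M : ModOver B) : ModOver (CornerCategory E) where
  obj :=
    { obj := fun ε => AddCommGrpCat.of (M.obj.map ε.unop.obj.p.op).hom.range
      map := fun {ε ε'} α => AddCommGrpCat.ofHom
        (((M.obj.map α.unop.hom.f.op).hom.comp
          (M.obj.map ε.unop.obj.p.op).hom.range.subtype).codRestrict
            (M.obj.map ε'.unop.obj.p.op).hom.range (fun m => by
              refine ⟨M.obj.map α.unop.hom.f.op m.1, ?_⟩
              change (M.obj.map α.unop.hom.f.op ≫ M.obj.map ε'.unop.obj.p.op) m.1 = _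
              rw [← M.obj.map_comp, ← op_comp, Karoubi.p_comp]
              rfl))
      map_id := fun ε => by
        ext ⟨_, m, rfl⟩
        change (M.obj.map ε.unop.obj.p.op ≫ M.obj.map ε.unop.obj.p.op) m =
          M.obj.map ε.unop.obj.p.op m
        rw [← M.obj.map_comp, ← op_comp, Karoubi.idem]
      map_comp := fun {ε ε' ε''} α β => by
        ext m
        change M.obj.map (β.unop.hom.f ≫ α.unop.hom.f).op m.1 =
          (M.obj.map α.unop.hom.f.op ≫ M.obj.map β.unop.hom.f.op) m.1
        rw [← M.obj.map_comp, ← op_comp] }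
  property :=
    { map_add := fun {ε ε' α β} => by
        ext m
        change M.obj.map (α.unop.hom.f.op + β.unop.hom.f.op) m.1 =
          (M.obj.map α.unop.hom.f.op + M.obj.map β.unop.hom.f.op) m.1
        rw [M.obj.map_add] }

/-- The functor `Mod B ⥤ Mod C_E` given by `M ↦ (ε ↦ M(ε)(M(x)))`. -/
def cornerFunctor : ModOver B ⥤ ModOver (CornerCategory E) where
  obj M := cornerModule E M
  map {M N} f := ObjectProperty.homMk
    { app := fun ε => AddCommGrpCat.ofHom
        (((f.hom.app (.op ε.unop.obj.X)).hom.comp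
          (M.obj.map ε.unop.obj.p.op).hom.range.subtype).codRestrict
            (N.obj.map ε.unop.obj.p.op).hom.range (by
              rintro ⟨_, m, rfl⟩
              refine ⟨f.hom.app _ m, ?_⟩
              change (f.hom.app _ ≫ N.obj.map _) m = (M.obj.map _ ≫ f.hom.app _) m
              rw [f.hom.naturality]))
      naturality := fun ε ε' α => by
        ext m
        refine Subtype.ext ?_
        change (M.obj.map α.unop.hom.f.op ≫ f.hom.app _) m.1 =
          (f.hom.app _ ≫ N.obj.map α.unop.hom.f.op) m.1
        rw [f.hom.naturality] }
  map_id M := rfl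
  map_comp f g := rfl

end CornerFunctor

/-! ### Recollements -/

/-- A recollement of an abelian category `M` by abelian categories `Y` and `X`. -/
structure Recollement (Y : Type u₁) [Category.{v₁} Y] [Abelian Y]
    (M : Type u₂) [Category.{v₂} M] [Abelian M]
    (X : Type u₃) [Category.{v₃} X] [Abelian X] where
  /-- the functor `i_*` -/
  iLowerStar : Y ⥤ M
  /-- the functor `i^*` -/
  iUpperStar : M ⥤ Y
  /-- the functor `i^!` -/
  iUpperShriek : M ⥤ Y
  /-- the functor `j^*` -/
  jUpperStar : M ⥤ X
  /-- the functor `j_!` -/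
  jLowerShriek : X ⥤ M
  /-- the functor `j_*` -/
  jLowerStar : X ⥤ M
  iLowerStar_additive : iLowerStar.Additive
  iUpperStar_additive : iUpperStar.Additive
  iUpperShriek_additive : iUpperShriek.Additive
  jUpperStar_additive : jUpperStar.Additive
  jLowerShriek_additive : jLowerShriek.Additive
  jLowerStar_additive : jLowerStar.Additive
  /-- `(j_!, j^*, j_*)` is an adjoint triple -/
  jTriple : Adjunction.Triple jLowerShriek jUpperStar jLowerStar
  /-- `(i^*, i_*, i^!)` is an adjoint triple -/
  iTriple : Adjunction.Triple iUpperStar iLowerStar iUpperShriek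
  iLowerStar_full : iLowerStar.Full
  iLowerStar_faithful : iLowerStar.Faithful
  jLowerShriek_full : jLowerShriek.Full
  jLowerShriek_faithful : jLowerShriek.Faithful
  jLowerStar_full : jLowerStar.Full
  jLowerStar_faithful : jLowerStar.Faithful
  /-- the essential image of `i_*` is the kernel of `j^*` -/
  essImage_iff (m : M) : iLowerStar.essImage m ↔ IsZero (jUpperStar.obj m)

/-- Two recollements are equivalent if there are equivalences `Φ` of the middle categories and
`Ψ` of the right-hand categories that commute with the functors `j^*` up to a natural
isomorphism. -/
def Recollement.Equivalent
    {Y : Type u₁} [Category.{v₁} Y] [Abelian Y] {M : Type u₂} [Category.{v₂} M] [Abelian M]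
    {X : Type u₃} [Category.{v₃} X] [Abelian X]
    {Y' : Type u₄} [Category.{v₄} Y'] [Abelian Y'] {M' : Type u₅} [Category.{v₅} M'] [Abelian M']
    {X' : Type u₆} [Category.{v₆} X'] [Abelian X']
    (R : Recollement Y M X) (R' : Recollement Y' M' X') : Prop :=
  ∃ (Φ : M ≌ M') (Ψ : X ≌ X'),
    Nonempty (R.jUpperStar ⋙ Ψ.functor ≅ Φ.functor ⋙ R'.jUpperStar)

end RecollementMod

end

/-! Write `X ≌ Mod D` and let `L : Mod D ⥤ Mod A` and `G : Mod A ⥤ Mod D` be `j_!` and `j^*` read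
through this equivalence. Then `L` is fully faithful and left adjoint to `G`, and `G` has a right
adjoint as well. The category `B` is `Glue L`, the full subcategory of `Mod A` on the representables
`A(-, a)` and the modules `L D(-, d)`; `E` consists of the identities of the latter objects.

Morita equivalence: the functor `M ↦ Hom(-, M)` from `Mod A` to `Mod B`, followed by restriction to
`A`, is the identity by Yoneda. So it suffices that restriction along `A ⥤ B` is an equivalence, and
for this that every identity of `B` is a finite sum of morphisms factoring through representables
(`IdentityFactors`). For `L D(-, d)` this says that the module is finitely generated projective; it
holds because `Hom(L D(-, d), -) = (G -)(d)` and `G` is a left adjoint (`mem_closure_factors`).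

Identification of the functors: since `L` is fully faithful, `D` is equivalent to the corner
category, and the same adjunction formula turns `j^*` into the corner functor. A `B`-module is
killed by the corner functor exactly when `BEB` annihilates it, that is, when it comes from `B/BEB`.
Fully faithful functors with equal essential image differ by an equivalence, so the whole
recollement can be transported. -/

noncomputable section

namespace RecollementMod

open Opposite

/-! ### Elementwise description of modules -/

section Elements

variable {C : Type u} [SmallCategory C] [Preadditive C]

/-- The action `M(b) → M(a)` of a morphism `f : a ⟶ b` on a right module. -/
def act (M : ModOver C) {a b : C} (f : a ⟶ b) : M.obj.obj (op b) →+ M.obj.obj (op a) :=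
  (M.obj.map f.op).hom

/-- The component at `c` of a morphism of modules, as a group homomorphism. -/
def appHom {M N : ModOver C} (g : M ⟶ N) (c : C) : M.obj.obj (op c) →+ N.obj.obj (op c) :=
  (g.hom.app (op c)).hom

variable (M : ModOver C) {N P : ModOver C}

@[simp]
lemma act_id (c : C) (m : M.obj.obj (op c)) : act M (𝟙 c) m = m := by
  change M.obj.map (𝟙 (op c)) m = m
  simp

@[simp]
lemma act_comp {a b c : C} (f : a ⟶ b) (g : b ⟶ c) (m : M.obj.obj (op c)) :
    act M (f ≫ g) m = act M f (act M g m) := by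
  change M.obj.map (g.op ≫ f.op) m = _
  rw [M.obj.map_comp]
  rfl

@[simp]
lemma act_add {a b : C} (f g : a ⟶ b) (m : M.obj.obj (op b)) :
    act M (f + g) m = act M f m + act M g m := by
  change M.obj.map (f.op + g.op) m = _
  rw [M.obj.map_add]
  rfl

@[simp]
lemma act_zero {a b : C} (m : M.obj.obj (op b)) : act M (0 : a ⟶ b) m = 0 := by
  have := act_add M (0 : a ⟶ b) 0 m
  simpa using this

@[simp]
lemma act_neg {a b : C} (f : a ⟶ b) (m : M.obj.obj (op b)) :
    act M (-f) m = -act M f m := by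
  have := act_add M f (-f) m
  rw [add_neg_cancel, act_zero] at this
  exact (neg_eq_of_add_eq_zero_right this.symm).symm

@[simp]
lemma act_sub {a b : C} (f g : a ⟶ b) (m : M.obj.obj (op b)) :
    act M (f - g) m = act M f m - act M g m := by
  simp [sub_eq_add_neg]

variable {M}

@[simp]
lemma appHom_id (c : C) (m : M.obj.obj (op c)) : appHom (𝟙 M) c m = m := rfl

@[simp]
lemma appHom_comp (g : M ⟶ N) (h : N ⟶ P) (c : C) (m : M.obj.obj (op c)) :
    appHom (g ≫ h) c m = appHom h c (appHom g c m) := rfl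

lemma appHom_act (g : M ⟶ N) {a b : C} (f : a ⟶ b) (m : M.obj.obj (op b)) :
    appHom g a (act M f m) = act N f (appHom g b m) := by
  change (M.obj.map f.op ≫ g.hom.app (op a)) m = _
  rw [g.hom.naturality]
  rfl

lemma hom_ext_elements {g h : M ⟶ N} (H : ∀ c m, appHom g c m = appHom h c m) : g = h := by
  ext c m
  exact H c.unop m

variable (M N) in
/-- A morphism of modules from a natural family of homomorphisms. -/
def homOfApp (g : ∀ c : C, M.obj.obj (op c) →+ N.obj.obj (op c))
    (H : ∀ {a b : C} (f : a ⟶ b) m, g a (act M f m) = act N f (g b m)) : M ⟶ N :=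
  ObjectProperty.homMk
    { app := fun c => AddCommGrpCat.ofHom (g c.unop)
      naturality := fun a b f => by
        ext m
        exact H f.unop m }

variable (M N) in
/-- An isomorphism of modules from a natural family of isomorphisms. -/
def isoOfApp (g : ∀ c : C, M.obj.obj (op c) ≃+ N.obj.obj (op c))
    (H : ∀ {a b : C} (f : a ⟶ b) m, g a (act M f m) = act N f (g b m)) : M ≅ N where
  hom := homOfApp M N (fun c => (g c).toAddMonoidHom) H
  inv := homOfApp N M (fun c => (g c).symm.toAddMonoidHom) (fun {a b} f m => by
    refine (g a).injective ?_
    refine ((g a).apply_symm_apply _).trans (Eq.trans ?_ (H f _).symm)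
    exact congrArg _ ((g b).apply_symm_apply m).symm)
  hom_inv_id := hom_ext_elements fun c m => (g c).symm_apply_apply m
  inv_hom_id := hom_ext_elements fun c m => (g c).apply_symm_apply m

lemma act_eq_zero_of_mem_closure {a b : C} {S : Set (a ⟶ b)} {m : M.obj.obj (op b)}
    (h : ∀ f ∈ S, act M f m = 0) {f : a ⟶ b} (hf : f ∈ AddSubgroup.closure S) :
    act M f m = 0 := by
  induction hf using AddSubgroup.closure_induction with
  | mem f hf => exact h f hf
  | zero => simp
  | add f g _ _ hf hg => simp [hf, hg]
  | neg f _ hf => simp [hf]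

end Elements

/-! ### Representable modules -/

section Yoneda

variable {C : Type u} [SmallCategory C] [Preadditive C]

/-- The Yoneda embedding of a small preadditive category into its modules. -/
def modYoneda (C : Type u) [SmallCategory C] [Preadditive C] : C ⥤ ModOver C :=
  ObjectProperty.lift _ preadditiveYoneda fun X => CategoryTheory.additive_yonedaObj' X

/-- The Yoneda lemma. -/
def modYonedaEquiv (c : C) (M : ModOver C) :
    ((modYoneda C).obj c ⟶ M) ≃+ M.obj.obj (op c) where
  toFun g := appHom g c (𝟙 c)
  invFun m := homOfApp _ _ (fun a =>
      { toFun := fun f => act M f m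
        map_zero' := act_zero M m
        map_add' := fun f g => act_add M f g m }) (fun f g => act_comp M f g m)
  left_inv g := hom_ext_elements fun a f => by
    refine (appHom_act g f (𝟙 c)).symm.trans ?_
    exact congrArg (appHom g a) (Category.comp_id f)
  right_inv := act_id M c
  map_add' _ _ := rfl

lemma modYonedaEquiv_comp {c : C} {M N : ModOver C} (g : (modYoneda C).obj c ⟶ M)
    (h : M ⟶ N) : modYonedaEquiv c N (g ≫ h) = appHom h c (modYonedaEquiv c M g) := rfl

lemma modYonedaEquiv_map_comp {c d : C} {M : ModOver C} (f : c ⟶ d)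
    (g : (modYoneda C).obj d ⟶ M) :
    modYonedaEquiv c M ((modYoneda C).map f ≫ g) = act M f (modYonedaEquiv d M g) := by
  refine Eq.trans ?_ (appHom_act g f (𝟙 d))
  refine congrArg (appHom g c) ?_
  change 𝟙 c ≫ f = f ≫ 𝟙 d
  simp

instance : (modYoneda C).Additive where
  map_add {_ _ f g} := hom_ext_elements fun _ m => Preadditive.comp_add _ _ _ m f g

instance : (modYoneda C).Full where
  map_surjective {c d} g := ⟨modYonedaEquiv c _ g, (modYonedaEquiv c _).injective (by
    change 𝟙 c ≫ modYonedaEquiv c _ g = _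
    exact Category.id_comp _)⟩

instance : (modYoneda C).Faithful where
  map_injective {c d f g} h := by
    have := congrArg (modYonedaEquiv c _) h
    change 𝟙 c ≫ f = 𝟙 c ≫ g at this
    simpa using this

end Yoneda

/-! ### The coinduced module of a group -/

section Coinduced

variable {C : Type u} [SmallCategory C] [Preadditive C]

/-- The module `a ↦ Hom(C(c, a), Q)`. -/
def coinduced (c : C) (Q : AddCommGrpCat.{u}) : ModOver C :=
  AdditiveFunctor.of ((preadditiveCoyoneda.obj (op c)).op ⋙ preadditiveYoneda.obj Q)

/-- The homomorphism `C(c, a) → Q` that an element of the coinduced module is. -/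
def coinducedEquiv (c : C) (Q : AddCommGrpCat.{u}) (a : C) :
    ((c ⟶ a) →+ Q) ≃+ (coinduced c Q).obj.obj (op a) where
  toFun g := AddCommGrpCat.ofHom g
  invFun g := AddCommGrpCat.Hom.hom g
  left_inv _ := rfl
  right_inv _ := rfl
  map_add' _ _ := rfl

/-- The homomorphism `M(a) → Hom(C(c, a), Q)` that corresponds to a homomorphism `M(c) → Q`. -/
def actHom (M : ModOver C) (c : C) {Q : AddCommGrpCat.{u}} (q : M.obj.obj (op c) →+ Q) (a : C) :
    M.obj.obj (op a) →+ ((c ⟶ a) →+ Q) where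
  toFun m :=
    { toFun := fun f => q (act M f m)
      map_zero' := by simp
      map_add' := by simp }
  map_zero' := by ext; simp
  map_add' _ _ := by ext; simp

/-- The morphism into the coinduced module that corresponds to a homomorphism `M(c) → Q`. -/
def toCoinduced (M : ModOver C) (c : C) (Q : AddCommGrpCat.{u})
    (q : M.obj.obj (op c) →+ Q) : M ⟶ coinduced c Q :=
  homOfApp _ _ (fun a => (coinducedEquiv c Q a).toAddMonoidHom.comp (actHom M c q a))
    (fun {a b} f m => (coinducedEquiv c Q a).symm.injective (by
      ext g
      exact congrArg q (act_comp M g f m).symm))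

/-- Evaluation at `𝟙 c` recovers `q`. Coinduced modules thus turn a group homomorphism on the single
value `M(c)` into a module morphism, to which adjunctions apply. -/
lemma eq_zero_of_toCoinduced_eq_zero {M : ModOver C} {c : C} {Q : AddCommGrpCat.{u}}
    {q : M.obj.obj (op c) →+ Q} (h : toCoinduced M c Q q = 0) : q = 0 := by
  ext m
  have h₁ : coinducedEquiv c Q c (actHom M c q c m) = 0 :=
    congrArg (fun g => appHom g c m) h
  rw [EmbeddingLike.map_eq_zero_iff] at h₁
  have h₂ : q (act M (𝟙 c) m) = 0 := DFunLike.congr_fun h₁ (𝟙 c)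
  simpa using h₂

lemma comp_toCoinduced_eq_zero {M N : ModOver C} {c : C} {Q : AddCommGrpCat.{u}}
    {q : M.obj.obj (op c) →+ Q} (f : N ⟶ M) (h : ∀ n, q (appHom f c n) = 0) :
    f ≫ toCoinduced M c Q q = 0 := by
  refine hom_ext_elements fun a n => ?_
  refine (coinducedEquiv c Q a).symm.injective ?_
  ext g
  change q (act M g (appHom f a n)) = 0
  rw [← appHom_act, h]

end Coinduced

/-! ### Restriction of scalars -/

section IdentityFactors

variable {C D : Type u} [SmallCategory C] [SmallCategory D] [Preadditive D] (φ : C ⥤ D)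

/-- The identity of every object of `D` is a sum of morphisms that factor through the image
of `φ`. -/
def IdentityFactors : Prop :=
  ∀ d : D, 𝟙 d ∈ AddSubgroup.closure
    {f : d ⟶ d | ∃ (c : C) (γ : d ⟶ φ.obj c) (δ : φ.obj c ⟶ d), f = γ ≫ δ}

variable {φ}

/-- The action of `𝟙 d` is a sum of actions of composites `γ ≫ δ`, and each of these passes through
some action of `δ : φ.obj c ⟶ d`. -/
lemma IdentityFactors.element_ext (hφ : IdentityFactors φ) {M : ModOver D} {d : D}
    {m n : M.obj.obj (op d)} (h : ∀ (c : C) (β : φ.obj c ⟶ d), act M β m = act M β n) :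
    m = n := by
  have : act M (𝟙 d) (m - n) = 0 := by
    refine act_eq_zero_of_mem_closure ?_ (hφ d)
    rintro _ ⟨c, γ, δ, rfl⟩
    simp [h]
  simpa [sub_eq_zero] using this

/-- A gluing principle: if `𝟙 d = ∑ γᵢ ≫ δᵢ`, then `n = ∑ γᵢ · ψ(δᵢ)` is the required element. -/
lemma IdentityFactors.exists_element [φ.Full] (hφ : IdentityFactors φ) (N : ModOver D) (d : D)
    (ψ : ∀ c : C, (φ.obj c ⟶ d) →+ N.obj.obj (op (φ.obj c)))
    (hψ : ∀ {c c' : C} (r : c ⟶ c') (β : φ.obj c' ⟶ d),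
      ψ c (φ.map r ≫ β) = act N (φ.map r) (ψ c' β)) :
    ∃ n : N.obj.obj (op d), ∀ (c : C) (β : φ.obj c ⟶ d), act N β n = ψ c β := by
  -- Replacing `𝟙 d` by an arbitrary `f` makes the claim additive in `f`, so that closure induction
  -- applies.
  suffices H : ∀ f ∈ AddSubgroup.closure
      {f : d ⟶ d | ∃ (c : C) (γ : d ⟶ φ.obj c) (δ : φ.obj c ⟶ d), f = γ ≫ δ},
      ∃ n : N.obj.obj (op d), ∀ (c : C) (β : φ.obj c ⟶ d), act N β n = ψ c (β ≫ f) by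
    simpa using H _ (hφ d)
  intro f hf
  induction hf using AddSubgroup.closure_induction with
  | mem f hf =>
    obtain ⟨c', γ, δ, rfl⟩ := hf
    refine ⟨act N γ (ψ c' δ), fun c β => ?_⟩
    -- Fullness is needed because `ψ` is only compatible with morphisms in the image of `φ`.
    obtain ⟨r, hr⟩ := φ.map_surjective (β ≫ γ)
    rw [← act_comp, ← hr, ← hψ, hr, Category.assoc]
  | zero => exact ⟨0, by simp⟩
  | add f g _ _ hf hg =>
    obtain ⟨m, hm⟩ := hf
    obtain ⟨n, hn⟩ := hg
    exact ⟨m + n, by simp [hm, hn]⟩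
  | neg f _ hf =>
    obtain ⟨m, hm⟩ := hf
    exact ⟨-m, by simp [hm]⟩

end IdentityFactors

section Restrict

variable {C D : Type u} [SmallCategory C] [Preadditive C] [SmallCategory D] [Preadditive D]
  (φ : C ⥤ D) [φ.Additive]

instance : (restrictScalars φ).Additive where
  map_add := rfl

variable {φ}

lemma IdentityFactors.restrictScalars_faithful (hφ : IdentityFactors φ) :
    (restrictScalars φ).Faithful where
  map_injective {M N g h} H := hom_ext_elements fun d m => hφ.element_ext fun c β => by
    rw [← appHom_act, ← appHom_act]
    exact congrArg (fun k => appHom k c (act M β m)) H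

lemma IdentityFactors.restrictScalars_full [φ.Full] (hφ : IdentityFactors φ) :
    (restrictScalars φ).Full where
  map_surjective {M N} g := by
    have H (d : D) (m : M.obj.obj (op d)) : ∃ n : N.obj.obj (op d),
        ∀ (c : C) (β : φ.obj c ⟶ d), act N β n = appHom g c (act M β m) :=
      hφ.exists_element N d
        (fun c => AddMonoidHom.comp (appHom g c)
          { toFun := fun β => act M β m
            map_zero' := act_zero M m
            map_add' := fun f f' => act_add M f f' m })
        (fun r β => by
          refine Eq.trans ?_ (appHom_act g r _)
          exact congrArg _ (act_comp M _ _ m))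
    choose k hk using H
    refine ⟨homOfApp M N (fun d => AddMonoidHom.mk' (k d) fun m n => ?_) fun f m => ?_, ?_⟩
    · refine hφ.element_ext fun c β => ?_
      rw [hk, map_add, map_add, hk, hk]
      exact map_add (appHom g c) _ _
    · refine hφ.element_ext fun c β => ?_
      change act N β (k _ _) = act N β (act N f (k _ m))
      rw [hk, ← act_comp, ← act_comp, hk]
    · refine hom_ext_elements fun c m => ?_
      change k (φ.obj c) m = appHom g c m
      refine hφ.element_ext fun c' β => ?_
      refine (hk _ _ _ _).trans ?_
      obtain ⟨r, rfl⟩ := φ.map_surjective β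
      exact appHom_act g r m

variable (φ) in
lemma restrictScalars_essSurj_of_isEquivalence [φ.IsEquivalence] :
    (restrictScalars φ).EssSurj where
  mem_essImage M := by
    have : φ.asEquivalence.functor.Additive := inferInstanceAs φ.Additive
    have : φ.inv.Additive := inferInstanceAs φ.asEquivalence.inverse.Additive
    refine ⟨(restrictScalars φ.inv).obj M, ⟨?_⟩⟩
    refine ObjectProperty.isoMk _ ?_
    exact Functor.isoWhiskerRight (NatIso.op φ.asEquivalence.unitIso) M.obj ≪≫
      M.obj.leftUnitor

variable (φ) in
lemma restrictScalars_isEquivalence [φ.IsEquivalence] :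
    (restrictScalars φ).IsEquivalence := by
  have hφ : IdentityFactors φ := fun d =>
    AddSubgroup.subset_closure ⟨_, (φ.objObjPreimageIso d).inv, (φ.objObjPreimageIso d).hom,
      by simp⟩
  have := hφ.restrictScalars_faithful
  have := hφ.restrictScalars_full
  have := restrictScalars_essSurj_of_isEquivalence φ
  exact { }

end Restrict

/-! ### The module of morphisms from a family of modules -/

section Nerve

variable {A B : Type u} [SmallCategory A] [Preadditive A] [SmallCategory B] [Preadditive B]
  (F : B ⥤ ModOver A) [F.Additive]

/-- The functor that sends an `A`-module `M` to the `B`-module `b ↦ Hom(F b, M)`. -/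
def nerve : ModOver A ⥤ ModOver B where
  obj M := AdditiveFunctor.of (F.op ⋙ preadditiveYoneda.obj M)
  map f := ObjectProperty.homMk (Functor.whiskerLeft F.op (preadditiveYoneda.map f))
  map_id M := by rw [CategoryTheory.Functor.map_id]; rfl
  map_comp f g := by rw [CategoryTheory.Functor.map_comp]; rfl

end Nerve

/-! ### Gluing two small preadditive categories along a functor of module categories -/

section Glue

variable {A D : Type u} [SmallCategory A] [Preadditive A] [SmallCategory D] [Preadditive D]
  (L : ModOver D ⥤ ModOver A)

/-- The full subcategory of `Mod A` on the representable modules and on the images under `L` of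
the representable `D`-modules. -/
abbrev Glue :=
  InducedCategory (ModOver A)
    (Sum.elim (fun a : A => (modYoneda A).obj a) (fun d : D => L.obj ((modYoneda D).obj d)))

/-- The inclusion of `Glue L` in `Mod A`. -/
abbrev Glue.toMod : Glue L ⥤ ModOver A := inducedFunctor _

/-- The inclusion of `A` in `Glue L`. -/
def Glue.inl : A ⥤ Glue L where
  obj a := (Sum.inl a : A ⊕ D)
  map f := InducedCategory.homMk ((modYoneda A).map f)
  map_id a := InducedCategory.hom_ext ((modYoneda A).map_id a)
  map_comp f g := InducedCategory.hom_ext ((modYoneda A).map_comp f g)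

/-- The inclusion of `D` in `Glue L`. -/
def Glue.inr : D ⥤ Glue L where
  obj d := (Sum.inr d : A ⊕ D)
  map f := InducedCategory.homMk (L.map ((modYoneda D).map f))
  map_id d := InducedCategory.hom_ext ((modYoneda D ⋙ L).map_id d)
  map_comp f g := InducedCategory.hom_ext ((modYoneda D ⋙ L).map_comp f g)

instance : (Glue.inl L).Additive where
  map_add := InducedCategory.hom_ext (modYoneda A).map_add

instance [L.Additive] : (Glue.inr L).Additive where
  map_add := InducedCategory.hom_ext (modYoneda D ⋙ L).map_add

instance : (Glue.inl L).Full where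
  map_surjective f :=
    ⟨(modYoneda A).preimage f.hom, InducedCategory.hom_ext ((modYoneda A).map_preimage f.hom)⟩

variable {L} in
/-- The inclusions of `D` in `Glue L` and in `Mod A` agree. -/
def Glue.inrCompToMod : Glue.inr L ⋙ Glue.toMod L ≅ modYoneda D ⋙ L := Iso.refl _

instance [L.Full] : (Glue.inr L).Full := Functor.Full.of_comp_faithful_iso Glue.inrCompToMod

instance [L.Faithful] : (Glue.inr L).Faithful := Functor.Faithful.of_comp_iso Glue.inrCompToMod

/-- Restriction to `A` of the module that `M` defines over `Glue L` gives back `M`. -/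
def nerveRestrictInlIso :
    nerve (Glue.toMod L) ⋙ restrictScalars (Glue.inl L) ≅ 𝟭 (ModOver A) :=
  NatIso.ofComponents
    (fun M => isoOfApp ((nerve (Glue.toMod L) ⋙ restrictScalars (Glue.inl L)).obj M) M
      (fun a => modYonedaEquiv a M) (fun f m => modYonedaEquiv_map_comp f m))
    (fun _ => hom_ext_elements fun _ _ => rfl)

/-! ### Consequences of the adjunctions for `L` and `G` -/

variable {L} {G : ModOver A ⥤ ModOver D} {R : ModOver D ⥤ ModOver A}

/-- Morphisms from `L (D(-, d))` to `M` are elements of `(G M)(d)`. -/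
def leftAdjointYonedaEquiv (adj : L ⊣ G) [G.Additive] (d : D) (M : ModOver A) :
    (L.obj ((modYoneda D).obj d) ⟶ M) ≃+ (G.obj M).obj.obj (op d) :=
  AddEquiv.trans
    (AddEquiv.mk' (adj.homEquiv ((modYoneda D).obj d) M) fun f g => by
      simp [Adjunction.homEquiv_unit])
    (modYonedaEquiv d (G.obj M))

lemma leftAdjointYonedaEquiv_comp (adj : L ⊣ G) [G.Additive] {d : D} {M N : ModOver A}
    (g : L.obj ((modYoneda D).obj d) ⟶ M) (h : M ⟶ N) :
    leftAdjointYonedaEquiv adj d N (g ≫ h) =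
      appHom (G.map h) d (leftAdjointYonedaEquiv adj d M g) := by
  change modYonedaEquiv d _ (adj.homEquiv _ _ (g ≫ h)) = _
  rw [adj.homEquiv_naturality_right]
  rfl

lemma leftAdjointYonedaEquiv_map_comp (adj : L ⊣ G) [G.Additive] {c d : D} {M : ModOver A}
    (f : c ⟶ d) (g : L.obj ((modYoneda D).obj d) ⟶ M) :
    leftAdjointYonedaEquiv adj c M (L.map ((modYoneda D).map f) ≫ g) =
      act (G.obj M) f (leftAdjointYonedaEquiv adj d M g) := by
  change modYonedaEquiv c _ (adj.homEquiv _ _ (L.map _ ≫ g)) = _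
  rw [adj.homEquiv_naturality_left, modYonedaEquiv_map_comp]
  rfl

/-- Restriction to `D` of the module that `M` defines over `Glue L` gives `G M`. -/
def nerveRestrictInrIso (adj : L ⊣ G) [L.Additive] [G.Additive] :
    nerve (Glue.toMod L) ⋙ restrictScalars (Glue.inr L) ≅ G :=
  NatIso.ofComponents
    (fun M => isoOfApp ((nerve (Glue.toMod L) ⋙ restrictScalars (Glue.inr L)).obj M) (G.obj M)
      (fun d => leftAdjointYonedaEquiv adj d M)
      (fun f m => leftAdjointYonedaEquiv_map_comp adj f m))
    (fun h => hom_ext_elements fun _ m => leftAdjointYonedaEquiv_comp adj m h)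

/-- A morphism of modules vanishes if it vanishes on all morphisms from representables. -/
lemma eq_zero_of_yoneda_comp_eq_zero {M N : ModOver A} {g : M ⟶ N}
    (h : ∀ (a : A) (f : (modYoneda A).obj a ⟶ M), f ≫ g = 0) : g = 0 :=
  hom_ext_elements fun a m => by
    obtain ⟨f, rfl⟩ := (modYonedaEquiv a M).surjective m
    rw [← modYonedaEquiv_comp, h]
    rfl

/-- If `G` also has a right adjoint, then morphisms from `L (D(-, d))` are sums of morphisms that
factor through representables. -/
lemma mem_closure_factors (adj : L ⊣ G) (adj' : G ⊣ R) [G.Additive] (d : D) {M : ModOver A}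
    (g : L.obj ((modYoneda D).obj d) ⟶ M) :
    g ∈ AddSubgroup.closure {f | ∃ (a : A) (γ : L.obj ((modYoneda D).obj d) ⟶ (modYoneda A).obj a)
      (δ : (modYoneda A).obj a ⟶ M), f = γ ≫ δ} := by
  set S := AddSubgroup.closure {f : L.obj ((modYoneda D).obj d) ⟶ M |
    ∃ (a : A) (γ : L.obj ((modYoneda D).obj d) ⟶ (modYoneda A).obj a)
      (δ : (modYoneda A).obj a ⟶ M), f = γ ≫ δ} with hS
  let e := leftAdjointYonedaEquiv adj d M
  -- The quotient by `S`, viewed on `(G M)(d)`, becomes a morphism `t` from `G M` to a coinduced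
  -- module. It suffices to show `t = 0`.
  let q : (G.obj M).obj.obj (op d) →+ AddCommGrpCat.of ((L.obj ((modYoneda D).obj d) ⟶ M) ⧸ S) :=
    (QuotientAddGroup.mk' S).comp e.symm.toAddMonoidHom
  let t := toCoinduced (G.obj M) d _ q
  -- The transpose of `t` has source `M`, so it can be tested on representables. There it vanishes,
  -- since a morphism that factors through a representable lies in `S`.
  have ht : (adj'.homEquiv _ _ t) = 0 := by
    refine eq_zero_of_yoneda_comp_eq_zero fun a f => ?_
    have h0 : G.map f ≫ t = 0 := by
      refine comp_toCoinduced_eq_zero _ fun n => ?_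
      obtain ⟨γ, rfl⟩ := (leftAdjointYonedaEquiv adj d _).surjective n
      rw [← leftAdjointYonedaEquiv_comp]
      refine (congrArg (QuotientAddGroup.mk' S) (e.symm_apply_apply _)).trans ?_
      exact (QuotientAddGroup.eq_zero_iff _).2 (AddSubgroup.subset_closure ⟨a, γ, f, rfl⟩)
    have := adj'.right_adjoint_additive
    rw [← adj'.homEquiv_naturality_left, h0, adj'.homEquiv_unit, Functor.map_zero, comp_zero]
  have ht' : t = 0 := by
    have := adj'.right_adjoint_additive
    refine (adj'.homEquiv _ _).injective (ht.trans ?_)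
    rw [adj'.homEquiv_unit, Functor.map_zero, comp_zero]
  have hq : q (e g) = 0 := by rw [eq_zero_of_toCoinduced_eq_zero ht']; rfl
  refine (QuotientAddGroup.eq_zero_iff g).1 (Eq.trans ?_ hq)
  exact (congrArg (QuotientAddGroup.mk' S) (e.symm_apply_apply g)).symm

lemma identityFactors_inl (adj : L ⊣ G) (adj' : G ⊣ R) [G.Additive] :
    IdentityFactors (Glue.inl L) := by
  rintro (a | d)
  · exact AddSubgroup.subset_closure ⟨a, 𝟙 ((Glue.inl L).obj a), 𝟙 ((Glue.inl L).obj a),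
      (Category.id_comp (𝟙 ((Glue.inl L).obj a))).symm⟩
  -- `ι` carries the decomposition of the identity from `Mod A` into the full subcategory `Glue L`.
  · let ι : (L.obj ((modYoneda D).obj d) ⟶ L.obj ((modYoneda D).obj d)) →+
        ((Glue.inr L).obj d ⟶ (Glue.inr L).obj d) :=
      AddMonoidHom.mk' (fun f => InducedCategory.homMk f) fun _ _ => rfl
    have h := AddSubgroup.mem_map_of_mem ι
      (mem_closure_factors adj adj' d (𝟙 (L.obj ((modYoneda D).obj d))))
    rw [AddMonoidHom.map_closure] at h
    refine AddSubgroup.closure_mono ?_ h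
    rintro _ ⟨_, ⟨a, γ, δ, rfl⟩, rfl⟩
    exact ⟨a, InducedCategory.homMk γ, InducedCategory.homMk δ, rfl⟩

/-- `Glue L` is Morita equivalent to `A`. -/
lemma nerve_toMod_isEquivalence (adj : L ⊣ G) (adj' : G ⊣ R) [G.Additive] :
    (nerve (Glue.toMod L)).IsEquivalence := by
  have hφ := identityFactors_inl adj adj'
  have := hφ.restrictScalars_faithful
  have := hφ.restrictScalars_full
  have : (restrictScalars (Glue.inl L)).EssSurj :=
    ⟨fun M => ⟨_, ⟨(nerveRestrictInlIso L).app M⟩⟩⟩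
  have : (restrictScalars (Glue.inl L)).IsEquivalence := { }
  have : (nerve (Glue.toMod L) ⋙ restrictScalars (Glue.inl L)).IsEquivalence :=
    Functor.isEquivalence_of_iso (nerveRestrictInlIso L).symm
  -- Two out of three: the restriction and the composite are both equivalences.
  exact Functor.isEquivalence_of_comp_right _ (restrictScalars (Glue.inl L))

/-! ### The corner category of the second summand -/

variable (L) in
/-- The identities of the objects of `Glue L` that come from `D`. -/
def Glue.idempotents : Set (Karoubi (Glue L)) :=
  Set.range fun d : D => (toKaroubi (Glue L)).obj ((Glue.inr L).obj d)

variable (L) in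
/-- The functor from `D` to the corner category. -/
def Glue.toCorner : D ⥤ CornerCategory (Glue.idempotents L) :=
  ObjectProperty.lift _ (Glue.inr L ⋙ toKaroubi (Glue L)) fun d => ⟨d, rfl⟩

instance [L.Additive] : (Glue.toCorner L).Additive where
  map_add := ObjectProperty.hom_ext _ (Glue.inr L ⋙ toKaroubi (Glue L)).map_add

instance [L.Full] [L.Faithful] : (Glue.toCorner L).IsEquivalence where
  full := Functor.Full.of_comp_faithful_iso (H := Glue.inr L ⋙ toKaroubi (Glue L))
    (ObjectProperty.liftCompιIso _ _ _)
  faithful := Functor.Faithful.of_comp_iso (H := Glue.inr L ⋙ toKaroubi (Glue L))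
    (ObjectProperty.liftCompιIso _ _ _)
  essSurj := ⟨by
    rintro ⟨_, d, rfl⟩
    exact ⟨d, ⟨Iso.refl _⟩⟩⟩

variable (L) in
/-- The corner functor amounts to restriction to `D`. -/
def cornerRestrictIso [L.Additive] :
    cornerFunctor (Glue.idempotents L) ⋙ restrictScalars (Glue.toCorner L) ≅
      restrictScalars (Glue.inr L) :=
  NatIso.ofComponents
    (fun M => isoOfApp
      ((cornerFunctor (Glue.idempotents L) ⋙ restrictScalars (Glue.toCorner L)).obj M)
      ((restrictScalars (Glue.inr L)).obj M)
      (fun d =>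
        { toFun := Subtype.val
          -- The idempotent is an identity, so its image is the whole group and `m` is its own
          -- preimage.
          invFun := fun m => ⟨m, m, act_id M ((Glue.inr L).obj d) m⟩
          left_inv := fun _ => rfl
          right_inv := fun _ => rfl
          map_add' := fun _ _ => rfl })
      (fun _ _ => rfl))
    (fun _ => hom_ext_elements fun _ _ => rfl)

end Glue

/-! ### Modules over a quotient category -/

section Quotient

variable {B : Type u} [SmallCategory B] [Preadditive B]

instance (I : CatIdeal B) : (restrictScalars I.proj).Faithful where
  map_injective H := hom_ext_elements fun b m => congrArg (fun k => appHom k b.as m) H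

instance (I : CatIdeal B) : (restrictScalars I.proj).Full where
  map_surjective {M N} g :=
    ⟨homOfApp M N (fun b => appHom g b.as) (fun f m => by
        obtain ⟨f, rfl⟩ := I.proj.map_surjective f
        exact appHom_act g f m),
      rfl⟩

/-- A module that is annihilated by an ideal is a module over the quotient category. -/
def CatIdeal.descend (I : CatIdeal B) (M : ModOver B)
    (h : ∀ {a b : B} (f : a ⟶ b), f ∈ I.carrier a b → ∀ m, act M f m = 0) :
    ModOver I.QuotientCategory where
  obj := (CategoryTheory.Quotient.lift I.homRel M.obj.rightOp fun a b f g hfg => by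
    refine Quiver.Hom.unop_inj ?_
    ext m
    have := h _ hfg m
    rw [act_sub, sub_eq_zero] at this
    exact this).leftOp
  property :=
    { map_add := by
        rintro ⟨a⟩ ⟨b⟩ ⟨f⟩ ⟨g⟩
        obtain ⟨f, rfl⟩ := I.proj.map_surjective f
        obtain ⟨g, rfl⟩ := I.proj.map_surjective g
        ext m
        exact act_add M f g m }

lemma CatIdeal.essImage_restrictScalars_iff (I : CatIdeal B) (M : ModOver B) :
    (restrictScalars I.proj).essImage M ↔
      ∀ {a b : B} (f : a ⟶ b), f ∈ I.carrier a b → ∀ m, act M f m = 0 := by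
  constructor
  · rintro ⟨N, ⟨e⟩⟩ a b f hf m
    have hf' : I.proj.map f = 0 := by
      rw [← I.proj.map_zero]
      exact CategoryTheory.Quotient.sound _ (by simpa [CatIdeal.homRel] using hf)
    have he : appHom e.hom b (appHom e.inv b m) = m := by
      rw [← appHom_comp, e.inv_hom_id, appHom_id]
    rw [← he, ← appHom_act]
    refine (congrArg (appHom e.hom a) ?_).trans (map_zero _)
    refine (DFunLike.congr_fun (congrArg (act N) hf') (appHom e.inv b m)).trans ?_
    exact act_zero N _
  · intro h
    exact ⟨I.descend M h, ⟨Iso.refl _⟩⟩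

/-! ### The kernel of the corner functor -/

variable (E : Set (Karoubi B))

instance : (cornerFunctor E).Additive where
  map_add := rfl

lemma isZero_iff_forall_element {C : Type u} [SmallCategory C] [Preadditive C] (M : ModOver C) :
    IsZero M ↔ ∀ (c : C) (m : M.obj.obj (op c)), m = 0 := by
  rw [IsZero.iff_id_eq_zero]
  refine ⟨fun h c m => congrArg (fun k => appHom k c m) h, fun h => hom_ext_elements fun c m => ?_⟩
  rw [h c m, map_zero, map_zero]

lemma isZero_cornerFunctor_obj_iff (M : ModOver B) :
    IsZero ((cornerFunctor E).obj M) ↔ ∀ ε ∈ E, ∀ m, act M ε.p m = 0 := by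
  rw [isZero_iff_forall_element]
  constructor
  · intro h ε hε m
    exact congrArg Subtype.val (h ⟨ε, hε⟩ ⟨act M ε.p m, m, rfl⟩)
  · rintro h ⟨ε, hε⟩ ⟨_, m, rfl⟩
    exact Subtype.ext (h ε hε m)

lemma essImage_restrictScalars_proj_iff (M : ModOver B) :
    (restrictScalars (idealGenerated E).proj).essImage M ↔
      IsZero ((cornerFunctor E).obj M) := by
  rw [CatIdeal.essImage_restrictScalars_iff, isZero_cornerFunctor_obj_iff]
  constructor
  · intro h ε hε m
    -- By idempotency `ε = ε ∘ ε ∘ ε`, so `ε` lies in the ideal it generates.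
    exact h ε.p (AddSubgroup.subset_closure ⟨ε, hε, ε.p, ε.p, by simp⟩) m
  · intro h a b f hf m
    refine act_eq_zero_of_mem_closure ?_ hf
    rintro _ ⟨ε, hε, γ, δ, rfl⟩
    rw [act_comp, act_comp, h ε hε, map_zero]

end Quotient

/-! ### Transport of recollements -/

/-- Fully faithful functors with the same essential image differ by an equivalence. -/
lemma exists_equivalence_of_essImage_eq {Y : Type u₁} [Category.{v₁} Y] {M : Type u₂}
    [Category.{v₂} M] {Y' : Type u₃} [Category.{v₃} Y'] (F : Y ⥤ M) [F.Full] [F.Faithful]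
    (F' : Y' ⥤ M) [F'.Full] [F'.Faithful] (h : ∀ m, F.essImage m ↔ F'.essImage m) :
    ∃ K : Y' ≌ Y, Nonempty (K.functor ⋙ F ≅ F') := by
  let K := Functor.essImage.liftFunctor F' F fun y => (h _).2 (F'.obj_mem_essImage y)
  let e : K ⋙ F ≅ F' := Functor.essImage.liftFunctorCompIso F' F _
  have : K.Full := Functor.Full.of_comp_faithful_iso e
  have : K.Faithful := Functor.Faithful.of_comp_iso e
  have : K.EssSurj := ⟨fun y => by
    obtain ⟨y', ⟨i⟩⟩ := (h _).1 (F.obj_mem_essImage y)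
    exact ⟨y', ⟨F.preimageIso (e.app y' ≪≫ i)⟩⟩⟩
  have : K.IsEquivalence := { }
  exact ⟨K.asEquivalence, ⟨e⟩⟩

section Transport

variable {Y : Type u₁} [Category.{v₁} Y] [Abelian Y] {M : Type u₂} [Category.{v₂} M] [Abelian M]
  {X : Type u₃} [Category.{v₃} X] [Abelian X]
  {Y' : Type u₄} [Category.{v₄} Y'] [Abelian Y'] {M' : Type u₅} [Category.{v₅} M'] [Abelian M']
  {X' : Type u₆} [Category.{v₆} X'] [Abelian X']

/-- A recollement can be transported along equivalences. -/
lemma Recollement.exists_transport (R : Recollement Y M X) (Φ : M ≌ M') (Ψ : X ≌ X')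
    (i : Y' ⥤ M') [i.Additive] [i.Full] [i.Faithful] (j : M' ⥤ X') [j.Additive]
    (e : R.jUpperStar ⋙ Ψ.functor ≅ Φ.functor ⋙ j)
    (hij : ∀ m, i.essImage m ↔ IsZero (j.obj m)) :
    ∃ R' : Recollement Y' M' X', R'.iLowerStar = i ∧ R'.jUpperStar = j := by
  have := R.iLowerStar_full
  have := R.iLowerStar_faithful
  have := R.jLowerShriek_full
  have := R.jLowerShriek_faithful
  have := R.jLowerStar_full
  have := R.jLowerStar_faithful
  -- Both sides describe the kernel of `j`, since `Φ` carries the kernel of `R.jUpperStar` to it.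
  have hker (m : M') : (R.iLowerStar ⋙ Φ.functor).essImage m ↔ i.essImage m := by
    rw [hij]
    have e₁ : j.obj m ≅ Ψ.functor.obj (R.jUpperStar.obj (Φ.inverse.obj m)) :=
      j.mapIso (Φ.counitIso.app m).symm ≪≫ (e.app (Φ.inverse.obj m)).symm
    have h₁ : IsZero (j.obj m) ↔ IsZero (R.jUpperStar.obj (Φ.inverse.obj m)) :=
      ⟨fun h => (Ψ.inverse.map_isZero (h.of_iso e₁.symm)).of_iso (Ψ.unitIso.app _),
        fun h => (Ψ.functor.map_isZero h).of_iso e₁⟩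
    rw [h₁, ← R.essImage_iff]
    constructor
    · rintro ⟨y, ⟨k⟩⟩
      exact ⟨y, ⟨Φ.unitIso.app _ ≪≫ Φ.inverse.mapIso k⟩⟩
    · rintro ⟨y, ⟨k⟩⟩
      exact ⟨y, ⟨Φ.functor.mapIso k ≪≫ Φ.counitIso.app m⟩⟩
  obtain ⟨K, ⟨eK⟩⟩ := exists_equivalence_of_essImage_eq (R.iLowerStar ⋙ Φ.functor) i hker
  have ej : (Φ.inverse ⋙ R.jUpperStar) ⋙ Ψ.functor ≅ j :=
    Functor.associator _ _ _ ≪≫ Functor.isoWhiskerLeft Φ.inverse e ≪≫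
      (Functor.associator _ _ _).symm ≪≫ Functor.isoWhiskerRight Φ.counitIso j ≪≫ j.leftUnitor
  -- Only the outer adjoints are conjugated; `ofNatIsoRight` and `ofNatIsoLeft` keep `j`, and below
  -- `i`, as the given functors on the nose.
  let jT : Adjunction.Triple (Ψ.inverse ⋙ R.jLowerShriek ⋙ Φ.functor) j
      (Ψ.inverse ⋙ R.jLowerStar ⋙ Φ.functor) :=
    ⟨(Ψ.symm.toAdjunction.comp (R.jTriple.adj₁.comp Φ.toAdjunction)).ofNatIsoRight ej,
      ((Φ.symm.toAdjunction.comp R.jTriple.adj₂).comp Ψ.toAdjunction).ofNatIsoLeft ej⟩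
  let iT : Adjunction.Triple ((Φ.inverse ⋙ R.iUpperStar) ⋙ K.inverse) i
      ((Φ.inverse ⋙ R.iUpperShriek) ⋙ K.inverse) :=
    ⟨((Φ.symm.toAdjunction.comp R.iTriple.adj₁).comp K.symm.toAdjunction).ofNatIsoRight eK,
      (K.toAdjunction.comp (R.iTriple.adj₂.comp Φ.toAdjunction)).ofNatIsoLeft eK⟩
  exact ⟨{
    iLowerStar := i
    iUpperStar := _
    iUpperShriek := _
    jUpperStar := j
    jLowerShriek := _
    jLowerStar := _
    iLowerStar_additive := inferInstance
    iUpperStar_additive := iT.adj₁.left_adjoint_additive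
    iUpperShriek_additive := iT.adj₂.right_adjoint_additive
    jUpperStar_additive := inferInstance
    jLowerShriek_additive := jT.adj₁.left_adjoint_additive
    jLowerStar_additive := jT.adj₂.right_adjoint_additive
    jTriple := jT
    iTriple := iT
    iLowerStar_full := inferInstance
    iLowerStar_faithful := inferInstance
    jLowerShriek_full := inferInstance
    jLowerShriek_faithful := inferInstance
    jLowerStar_full := inferInstance
    jLowerStar_faithful := inferInstance
    essImage_iff := hij }, rfl, rfl⟩

end Transport

end RecollementMod

end

theorem mainTheorem6 {A : Type u} [SmallCategory A] [Preadditive A]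
    {Y : Type u₁} [Category.{v₁} Y] [Abelian Y] {X : Type u₂} [Category.{v₂} X] [Abelian X]
    (hY : RecollementMod.IsModuleCategory.{u} Y) (hX : RecollementMod.IsModuleCategory.{u} X)
    (R : RecollementMod.Recollement Y (RecollementMod.ModOver A) X) :
    ∃ (B : Type u) (_ : SmallCategory B) (_ : Preadditive B) (E : Set (Karoubi B))
      (R' : RecollementMod.Recollement
        (RecollementMod.ModOver (RecollementMod.idealGenerated E).QuotientCategory)
        (RecollementMod.ModOver B)
        (RecollementMod.ModOver (RecollementMod.CornerCategory E))),
      RecollementMod.MoritaEquivalent A B ∧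
      Nonempty (R'.iLowerStar ≅
        RecollementMod.restrictScalars (RecollementMod.idealGenerated E).proj) ∧
      Nonempty (R'.jUpperStar ≅ RecollementMod.cornerFunctor E) ∧
      R.Equivalent R' := by
  obtain ⟨D, _, _, ⟨e⟩⟩ := hX
  have := R.jLowerShriek_full
  have := R.jLowerShriek_faithful
  have := R.jUpperStar_additive
  let L : RecollementMod.ModOver D ⥤ RecollementMod.ModOver A := e.inverse ⋙ R.jLowerShriek
  let G : RecollementMod.ModOver A ⥤ RecollementMod.ModOver D := R.jUpperStar ⋙ e.functor
  have adj : L ⊣ G := e.symm.toAdjunction.comp R.jTriple.adj₁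
  have adj' : G ⊣ e.inverse ⋙ R.jLowerStar := R.jTriple.adj₂.comp e.toAdjunction
  have hL : L.Full := inferInstanceAs (e.inverse ⋙ R.jLowerShriek).Full
  have hL' : L.Faithful := inferInstanceAs (e.inverse ⋙ R.jLowerShriek).Faithful
  have he : e.functor.Additive := Functor.additive_of_preserves_binary_products e.functor
  have hG : G.Additive := inferInstanceAs (R.jUpperStar ⋙ e.functor).Additive
  have hLadd : L.Additive := adj.left_adjoint_additive
  have := RecollementMod.nerve_toMod_isEquivalence adj adj'
  have := RecollementMod.restrictScalars_isEquivalence (RecollementMod.Glue.toCorner L)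
  let N := RecollementMod.nerve (RecollementMod.Glue.toMod L)
  let T := RecollementMod.restrictScalars (RecollementMod.Glue.toCorner L)
  let Φ := N.asEquivalence
  let Ψ := e.trans T.asEquivalence.symm
  let J := RecollementMod.cornerFunctor (RecollementMod.Glue.idempotents L)
  have e₁ : N ⋙ J ⋙ T ≅ G :=
    Functor.isoWhiskerLeft N (RecollementMod.cornerRestrictIso L) ≪≫
      RecollementMod.nerveRestrictInrIso adj
  -- Obtained from `e₁` by cancelling the equivalence `T` on the right.
  have e₂ : R.jUpperStar ⋙ Ψ.functor ≅ Φ.functor ⋙ J :=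
    Functor.isoWhiskerRight e₁.symm T.asEquivalence.inverse ≪≫
      Functor.isoWhiskerLeft (N ⋙ J) T.asEquivalence.unitIso.symm ≪≫
      Functor.rightUnitor _
  obtain ⟨R', hi, hj⟩ := R.exists_transport Φ Ψ
    (RecollementMod.restrictScalars
      (RecollementMod.idealGenerated (RecollementMod.Glue.idempotents L)).proj) J e₂
    (RecollementMod.essImage_restrictScalars_proj_iff _)
  exact ⟨RecollementMod.Glue L, inferInstance, inferInstance, RecollementMod.Glue.idempotents L,
    R', ⟨Φ⟩, ⟨eqToIso hi⟩, ⟨eqToIso hj⟩, Φ, Ψ, ⟨e₂ ≪≫ Functor.isoWhiskerLeft _ (eqToIso hj.symm)⟩⟩
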